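/- Let $(W,S)$ be a Coxeter system with length function $\ell$, set of reflections $T=\{wsw^{-1}\mid w\in W,\ s\in S\}$, and $m_{ss'}$ the order of $ss'$. Let $V$ be a real vector space with a symmetric bilinear form $B$ and let $\Delta=\{\alpha_s\mid s\in S\}\subset V$ be positively linearly independent (a finite linear combination of the $\alpha_s$, $s\in S$, with non-negative coefficients vanishes only if all its coefficients do), such that $B(\alpha_s,\alpha_s)=1$ for all $s \in S$, $B(\alpha_s,\alpha_{s'})=-\cos(\pi/m_{ss'})$ if $m_{ss'}<\infty$, and $B(\alpha_s,\alpha_{s'})\le -1$ if $m_{ss'}=\infty$. Let $W$ act on $V$ by $s(v)=v-2B(\alpha_s,v)\alpha_s$ for $s\in S$. Put $\Phi=W(\Delta)$, $\Phi^+=\operatorname{cone}(\Delta)\cap\Phi$, $\Phi^-=-\Phi^+$, and for $w\in W$ let $\Phi(w)=\{\alpha\in\Phi^+\mid w^{-1}(\alpha)\in\Phi^-\}$ be its inversion set. For $\alpha\in\Phi^+$ and $t\in T$ write $t=s_\alpha$, and $\alpha=\alpha_t$, if $t(v)=v-2B(\alpha,v)\alpha$ for all $v\in V$. For $\alpha,\beta\in\Phi^+$,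 say that $\beta$ dominates $\alpha$, written $\alpha\le_d\beta$, if for all $w\in W$, $\beta\in\Phi(w)$ implies $\alpha\in\Phi(w)$. Let $\operatorname{Dom}(\beta)=\{\alpha\in\Phi^+\mid\alpha\le_d\beta\}$ and $\operatorname{dp}_\infty(\beta)=|\operatorname{Dom}(\beta)\setminus\{\beta\}|$. For $t\in T$, a $t$-prefix is an element $p_t\neq e$ of $W$ such that for every reduced word $s_1\cdots s_k s_{k+1}$ of $p_t$, the word $s_1\cdots s_k s_{k+1}s_k\cdots s_1$ is a reduced word of $t$. Let $\beta\in\Phi^+$ and let $t=s_\beta\in T$ be the corresponding reflection. Then for any $t$-prefix $p_t$, $$\operatorname{Dom}(\beta)=\{\alpha\in\Phi(p_t)\mid B(\alpha,\beta)\ge 1\}=\{\beta\}\sqcup\{\alpha_s\in\Phi(p_t)\mid s\in T,\ |\langle s,t\rangle|=\infty\},$$ where $\sqcup$ denotes a disjoint union. In particular, $$\operatorname{dp}_\infty(\beta)=|\{\alpha_s\in\Phi(p_t)\mid s\in T,\ |\langle s,t\rangle|=\infty\}|.$$ -/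

import Mathlib

/-- A simple system `Δ = {α_i}` in a real quadratic space `(V, B)`, of the type prescribed by a
Coxeter matrix `M`; by Mathlib's convention `M i j = 0` encodes `m_{ij} = ∞`. -/
structure GeometricData {I : Type*} (M : CoxeterMatrix I)
    (V : Type*) [AddCommGroup V] [Module ℝ V] where
  /-- the symmetric bilinear form `B` -/
  form : LinearMap.BilinForm ℝ V
  form_symm : form.IsSymm
  /-- the simple roots `α_i` -/
  simpleRoot : I → V
  /-- `Δ` is positively linearly independent -/
  pos_indep : ∀ c : I →₀ ℝ, (∀ i, 0 ≤ c i) →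
    (c.sum fun i a => a • simpleRoot i) = 0 → c = 0
  form_of_finite : ∀ i j, M i j ≠ 0 →
    form (simpleRoot i) (simpleRoot j) = -Real.cos (Real.pi / (M i j : ℝ))
  form_of_infinite : ∀ i j, M i j = 0 → form (simpleRoot i) (simpleRoot j) ≤ -1
  form_self : ∀ i, form (simpleRoot i) (simpleRoot i) = 1

namespace GeometricData

variable {I : Type*} {M : CoxeterMatrix I} {V : Type*} [AddCommGroup V] [Module ℝ V]
  (D : GeometricData M V)

theorem two_form_self (i : I) : ((2 : ℝ) • D.form (D.simpleRoot i)) (D.simpleRoot i) = 2 := by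
  simp [D.form_self]

/-- The reflection `v ↦ v - 2 B(α_i, v) α_i` in the simple root `α_i`. -/
noncomputable def simpleReflection (i : I) : V ≃ₗ[ℝ] V :=
  Module.reflection (D.two_form_self i)

theorem simpleReflection_apply (i : I) (v : V) :
    D.simpleReflection i v = v - (2 * D.form (D.simpleRoot i) v) • D.simpleRoot i := by
  simp [simpleReflection, Module.reflection_apply]

/-- The reflections in the simple roots satisfy the Coxeter relations. -/
theorem isLiftable : M.IsLiftable D.simpleReflection := by
  intro i j
  by_cases hij : i = j
  · subst hij
    have h : D.simpleReflection i * D.simpleReflection i = 1 := by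
      ext v
      exact Module.involutive_reflection (D.two_form_self i) v
    rw [h, one_pow]
  rcases Nat.eq_zero_or_pos (M i j) with h0 | hpos
  · rw [h0, pow_zero]
  have hne1 : M i j ≠ 1 := M.off_diagonal i j hij
  have hB := D.form_of_finite i j hpos.ne'
  have hB' : D.form (D.simpleRoot j) (D.simpleRoot i) = -Real.cos (Real.pi / (M i j : ℝ)) := by
    rw [← hB]
    exact D.form_symm.eq _ _
  by_cases h2 : M i j = 2
  · rw [h2] at hB hB' ⊢
    ext v
    simp [pow_two, LinearEquiv.mul_apply, simpleReflection_apply, hB, hB', D.form_self]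
    module
  have h3 : 3 ≤ M i j := by omega
  generalize M i j = m at hB hB' h3
  have hmR : (3 : ℝ) ≤ m := by exact_mod_cast h3
  set θ : ℝ := 2 * (Real.pi / m) with hθ
  have hmθ : (m : ℝ) * θ = 2 * Real.pi := by
    rw [hθ]; field_simp
  have hsin : Real.sin θ ≠ 0 := by
    apply (Real.sin_pos_of_pos_of_lt_pi (by positivity) _).ne'
    have : (3 : ℝ) * θ ≤ m * θ := by
      apply mul_le_mul_of_nonneg_right hmR (by positivity)
    linarith [Real.pi_pos]
  have hS : ∀ n : ℤ, (Polynomial.Chebyshev.S ℝ n).eval (2 * Real.cos θ) * Real.sin θ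
      = Real.sin ((n + 1) * θ) := fun n => Polynomial.Chebyshev.S_two_mul_real_cos θ n
  have ht : 2 * Real.cos θ = ((2 : ℝ) • D.form (D.simpleRoot i)) (D.simpleRoot j) *
      ((2 : ℝ) • D.form (D.simpleRoot j)) (D.simpleRoot i) - 2 := by
    simp only [LinearMap.smul_apply, hB, hB', smul_eq_mul, hθ, Real.cos_two_mul]
    ring
  apply LinearEquiv.ext
  intro v
  unfold simpleReflection
  rw [Module.reflection_mul_reflection_pow_apply _ _ m v _ ht]
  rcases Nat.even_or_odd' m with ⟨k, rfl | rfl⟩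
  · have e1 : (((2 * k : ℕ) : ℤ) - 2) / 2 = k - 1 := by push_cast; omega
    have e2 : (((2 * k : ℕ) : ℤ) - 1) / 2 = k - 1 := by push_cast; omega
    have hz : (Polynomial.Chebyshev.S ℝ ((k : ℤ) - 1)).eval (2 * Real.cos θ) = 0 := by
      have h := hS ((k : ℤ) - 1)
      have : (((k : ℤ) - 1 : ℤ) + 1 : ℝ) * θ = Real.pi := by
        push_cast at hmθ ⊢
        linarith
      rw [this, Real.sin_pi] at h
      exact (mul_eq_zero.mp h).resolve_right hsin
    rw [e1, e2, hz]
    simp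
  · have e1 : (((2 * k + 1 : ℕ) : ℤ) - 2) / 2 = k - 1 := by push_cast; omega
    have e2 : (((2 * k + 1 : ℕ) : ℤ) - 1) / 2 = k := by push_cast; omega
    have e3 : (((2 * k + 1 : ℕ) : ℤ) - 3) / 2 = k - 1 := by push_cast; omega
    have e4 : (((2 * k + 1 : ℕ) : ℤ)) / 2 = k := by push_cast; omega
    have hz : (Polynomial.Chebyshev.S ℝ (k : ℤ)).eval (2 * Real.cos θ) +
        (Polynomial.Chebyshev.S ℝ ((k : ℤ) - 1)).eval (2 * Real.cos θ) = 0 := by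
      have h := hS (k : ℤ)
      have h' := hS ((k : ℤ) - 1)
      have : (((k : ℤ) - 1 : ℤ) + 1 : ℝ) * θ = 2 * Real.pi - ((k : ℤ) + 1 : ℝ) * θ := by
        push_cast at hmθ ⊢
        linarith
      rw [this, Real.sin_two_pi_sub] at h'
      have h'' : ((Polynomial.Chebyshev.S ℝ (k : ℤ)).eval (2 * Real.cos θ) +
        (Polynomial.Chebyshev.S ℝ ((k : ℤ) - 1)).eval (2 * Real.cos θ)) * Real.sin θ = 0 := by
        rw [add_mul, h, h']; ring
      exact (mul_eq_zero.mp h'').resolve_right hsin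
    rw [e1, e2, e3, e4, hz]
    simp

variable {W : Type*} [Group W] (cs : CoxeterSystem M W)

/-- The geometric representation: the simple reflection `s_i` of `W` acts on `V` as the
reflection in `α_i`. -/
noncomputable def action : W →* (V ≃ₗ[ℝ] V) :=
  cs.lift ⟨D.simpleReflection, D.isLiftable⟩

theorem action_simple (i : I) : D.action cs (cs.simple i) = D.simpleReflection i :=
  cs.lift_apply_simple D.isLiftable i

/-- The root system `Φ = W(Δ)`. -/
def roots : Set V := {v | ∃ (w : W) (i : I), v = D.action cs w (D.simpleRoot i)}

/-- `cone(Δ)`: the linear combinations of simple roots with non-negative coefficients. -/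
def simpleCone : Set V :=
  {v | ∃ c : I →₀ ℝ, (∀ i, 0 ≤ c i) ∧ v = c.sum fun i a => a • D.simpleRoot i}

/-- The positive roots `Φ⁺ = cone(Δ) ∩ Φ`. -/
def posRoots : Set V := D.simpleCone ∩ D.roots cs

/-- The negative roots `Φ⁻ = -Φ⁺`. -/
def negRoots : Set V := {v | -v ∈ D.posRoots cs}

/-- The inversion set `Φ(w)`. -/
def inversionSet (w : W) : Set V :=
  {α | α ∈ D.posRoots cs ∧ D.action cs w⁻¹ α ∈ D.negRoots cs}

/-- The dominance order: `α ≤_d β`, that is, `β` dominates `α`. -/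
def DomLE (α β : V) : Prop :=
  ∀ w : W, β ∈ D.inversionSet cs w → α ∈ D.inversionSet cs w

/-- The dominance set `Dom(β)`. -/
def Dom (β : V) : Set V := {α | α ∈ D.posRoots cs ∧ D.DomLE cs α β}

/-- The dominance-depth `dp_∞(β)`: the number of positive roots other than `β`
that `β` dominates. -/
noncomputable def dpInf (β : V) : ℕ∞ :=
  {α | α ∈ D.posRoots cs \ {β} ∧ D.DomLE cs α β}.encard

/-- `t` is a reflection of `W` and `α` is its root: `t = s_α` and `α = α_t`. -/
def IsRootOf (t : W) (α : V) : Prop :=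
  cs.IsReflection t ∧ α ∈ D.posRoots cs ∧
    ∀ v, D.action cs t v = v - (2 * D.form α v) • α

end GeometricData

/-- `p` is a `t`-prefix: `p ≠ 1` and for every reduced word `s_1 ⋯ s_k r` of `p`, the word
`s_1 ⋯ s_k r s_k ⋯ s_1` is a (palindromic) reduced word of the reflection `t`. -/
def IsReflectionPrefix {I W : Type*} {M : CoxeterMatrix I} [Group W] (cs : CoxeterSystem M W)
    (t p : W) : Prop :=
  cs.IsReflection t ∧ p ≠ 1 ∧
    ∀ (ω : List I) (r : I), cs.IsReduced (ω ++ [r]) → cs.wordProd (ω ++ [r]) = p →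
      cs.IsReduced (ω ++ r :: ω.reverse) ∧ cs.wordProd (ω ++ r :: ω.reverse) = t

namespace GeometricData

/-! ### The pointed cone spanned by the simple roots -/

section Cone

variable {I : Type*} {M : CoxeterMatrix I} {V : Type*} [AddCommGroup V] [Module ℝ V]
  (D : GeometricData M V)

/-! Write the prefix as `p = u s_r`. Then `β = u(α_r)`, every inversion of `p` other than `β` is one
of `u`, and `Φ(u) ⊆ Φ(t)` because `u` begins a reduced word of `t`. Since `p` inverts `β`, it
inverts all that `β` dominates, so `Dom(β) ⊆ Φ(p)`. It remains to compare, for `α` in `Φ(u)`,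
dominance, the value `B(α, β)` and the infinitude of `⟨s, t⟩`, where `s = s_α`.

All three are read off the sequence `γ 0 = α`, `γ 1 = β`, `γ (n + 2) = 2 B(α, β) γ (n + 1) - γ n`
(`rootSeq`), whose even terms are the `(t s) ^ k α`. Two facts drive everything: such a recurrence
cannot stay in a pointed cone if its factor is below 2, as it would rotate (`two_le_of_recurrence`),
and an element of `W` has finitely many inversions (`finite_inversionSet`).

Dominance spreads along the sequence and keeps it positive, so `B(α, β) ≥ 1`
(`one_le_form_of_domLE`). Conversely, if `B(α, β) ≥ 1`, the `u⁻¹ γ n` with `n ≥ 1` are distinct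
positive roots; hence `t s` has infinite order, and a `w` inverting `β` but not `α` would give `u⁻¹
w` infinitely many inversions (`domLE_of_one_le_form`). If `⟨s, t⟩` is infinite, the even terms are
distinct and eventually of one sign, whence `B(α, β)² ≥ 1`; a negative value is excluded because `t
α = α - 2 B(α, β) β` is a negative root. -/

theorem zero_mem_simpleCone : (0 : V) ∈ D.simpleCone := ⟨0, by simp⟩

theorem simpleRoot_mem_simpleCone (i : I) : D.simpleRoot i ∈ D.simpleCone := by
  classical
  refine ⟨Finsupp.single i 1, fun j => ?_, by simp⟩
  rw [Finsupp.single_apply]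
  split_ifs <;> norm_num

theorem add_mem_simpleCone {x y : V} (hx : x ∈ D.simpleCone) (hy : y ∈ D.simpleCone) :
    x + y ∈ D.simpleCone := by
  classical
  obtain ⟨c, hc, rfl⟩ := hx
  obtain ⟨d, hd, rfl⟩ := hy
  refine ⟨c + d, fun i => add_nonneg (hc i) (hd i), ?_⟩
  rw [Finsupp.sum_add_index'] <;> simp [add_smul]

theorem smul_mem_simpleCone {x : V} {a : ℝ} (ha : 0 ≤ a) (hx : x ∈ D.simpleCone) :
    a • x ∈ D.simpleCone := by
  obtain ⟨c, hc, rfl⟩ := hx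
  refine ⟨a • c, fun i => mul_nonneg ha (hc i), ?_⟩
  rw [Finsupp.sum_smul_index' (by simp), Finsupp.smul_sum]
  simp [mul_smul]

theorem eq_zero_of_add_eq_zero {x y : V} (hx : x ∈ D.simpleCone) (hy : y ∈ D.simpleCone)
    (h : x + y = 0) : x = 0 := by
  classical
  obtain ⟨c, hc, rfl⟩ := hx
  obtain ⟨d, hd, rfl⟩ := hy
  have hcd : c + d = 0 := by
    refine D.pos_indep _ (fun i => add_nonneg (hc i) (hd i)) ?_
    rw [← h, Finsupp.sum_add_index'] <;> simp [add_smul]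
  have hc0 : c = 0 := by
    ext i
    have := DFunLike.congr_fun hcd i
    have h1 := hc i
    have h2 := hd i
    simp only [Finsupp.add_apply, Finsupp.zero_apply] at this ⊢
    linarith
  simp [hc0]

theorem eq_zero_of_neg_mem_simpleCone {x : V} (hx : x ∈ D.simpleCone)
    (hy : -x ∈ D.simpleCone) : x = 0 :=
  D.eq_zero_of_add_eq_zero hx hy (by simp)

theorem form_simpleRoot_nonpos {i j : I} (hij : i ≠ j) :
    D.form (D.simpleRoot i) (D.simpleRoot j) ≤ 0 := by
  by_cases h0 : M i j = 0
  · linarith [D.form_of_infinite i j h0]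
  · rw [D.form_of_finite i j h0, neg_nonpos]
    have h1 := M.off_diagonal i j hij
    have h2 : (2 : ℝ) ≤ M i j := by exact_mod_cast (by omega : 2 ≤ M i j)
    apply Real.cos_nonneg_of_neg_pi_div_two_le_of_le
    · have : 0 ≤ Real.pi / (M i j : ℝ) := by positivity
      linarith [Real.pi_pos]
    · gcongr

/-- Simple roots span extremal rays of the cone. -/
theorem exists_smul_of_add_eq_smul {x y : V} (hx : x ∈ D.simpleCone) (hy : y ∈ D.simpleCone)
    {i : I} {a : ℝ} (h : x + y = a • D.simpleRoot i) : ∃ b : ℝ, x = b • D.simpleRoot i := by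
  classical
  obtain ⟨c, hc, rfl⟩ := hx
  obtain ⟨d, hd, rfl⟩ := hy
  set e : I →₀ ℝ := c + d with he
  have hsum : (e.sum fun i a => a • D.simpleRoot i) = a • D.simpleRoot i := by
    rw [← h, he, Finsupp.sum_add_index'] <;> simp [add_smul]
  have he0 : ∀ j, 0 ≤ e j := fun j => add_nonneg (hc j) (hd j)
  set f : I →₀ ℝ := e.erase i with hf
  have hf0 : ∀ j, 0 ≤ f j := fun j => by
    rw [hf, Finsupp.erase_apply]; split_ifs <;> simp [he0]
  have hsplit : (f.sum fun i a => a • D.simpleRoot i) = (a - e i) • D.simpleRoot i := by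
    have h1 : e = Finsupp.single i (e i) + f := (Finsupp.single_add_erase i e).symm
    have h2 : (e.sum fun i a => a • D.simpleRoot i) =
        e i • D.simpleRoot i + f.sum fun i a => a • D.simpleRoot i := by
      conv_lhs => rw [h1]
      rw [Finsupp.sum_add_index'] <;> simp [add_smul]
    rw [sub_smul, ← hsum, h2]
    abel
  -- Pair with `α_i`, whose product with every other simple root is non-positive. The part of the
  -- sum away from `i` is then a non-positive multiple of `α_i`, so it vanishes because the cone is
  -- pointed. This stands in for linear independence.
  have hle : a - e i ≤ 0 := by
    have h1 := congrArg (D.form (D.simpleRoot i)) hsplit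
    rw [map_smul, D.form_self, smul_eq_mul, mul_one] at h1
    rw [← h1, Finsupp.sum, map_sum]
    refine Finset.sum_nonpos fun j _ => ?_
    rw [map_smul, smul_eq_mul]
    by_cases hij : i = j
    · subst hij; simp [hf]
    · exact mul_nonpos_of_nonneg_of_nonpos (hf0 j) (D.form_simpleRoot_nonpos hij)
  have hfz : f = 0 := by
    have hz : (f.sum fun i a => a • D.simpleRoot i) = 0 := by
      refine D.eq_zero_of_neg_mem_simpleCone ⟨f, hf0, rfl⟩ ?_
      rw [hsplit, ← neg_smul]
      exact D.smul_mem_simpleCone (by linarith) (D.simpleRoot_mem_simpleCone i)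
    exact D.pos_indep f hf0 hz
  refine ⟨c i, ?_⟩
  have hcs : c = Finsupp.single i (c i) := by
    ext j
    by_cases hij : i = j
    · subst hij; simp
    · have h1 := DFunLike.congr_fun hfz j
      rw [hf, Finsupp.erase_ne (Ne.symm hij)] at h1
      have h2 := hc j
      have h3 := hd j
      simp only [he, Finsupp.add_apply, Finsupp.zero_apply] at h1
      rw [Finsupp.single_eq_of_ne (Ne.symm hij)]
      linarith
  conv_lhs => rw [hcs]
  simp

/-- A sequence of nonzero vectors in the cone satisfying `γ (n + 2) + γ n = c γ (n + 1)` cannot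
rotate, that is, `2 ≤ c`. -/
theorem two_le_of_recurrence {γ : ℕ → V} {c : ℝ} (hγ : ∀ n, γ n ∈ D.simpleCone)
    (hγ0 : γ 0 ≠ 0) (hrec : ∀ n, γ (n + 2) + γ n = c • γ (n + 1)) : 2 ≤ c := by
  -- Even-indexed terms obey the same recurrence with `c ^ 2 - 2` in place of `c` (angle doubling
  -- for `c = 2 cos θ`). For `0 < c < 2` this at least doubles the gap `2 - c`, so `k` counts the
  -- doublings left. Once `c ≤ 0`, the recurrence writes 0 as a sum of cone vectors including `γ 0`.
  have key : ∀ (k : ℕ) (γ : ℕ → V) (c : ℝ), (∀ n, γ n ∈ D.simpleCone) → γ 0 ≠ 0 →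
      (∀ n, γ (n + 2) + γ n = c • γ (n + 1)) → c < 2 → 2 ≤ 2 ^ k * (2 - c) → False := by
    intro k
    induction k with
    | zero =>
      intro γ c hγ hγ0 hrec _ hk
      refine hγ0 (D.eq_zero_of_add_eq_zero (hγ 0)
        (D.add_mem_simpleCone (hγ 2)
          (D.smul_mem_simpleCone (a := -c) (by linarith) (hγ 1))) ?_)
      have := hrec 0
      rw [neg_smul, ← this]
      abel
    | succ k ih =>
      intro γ c hγ hγ0 hrec hc hk
      by_cases hc0 : c ≤ 0
      · refine hγ0 (D.eq_zero_of_add_eq_zero (hγ 0)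
          (D.add_mem_simpleCone (hγ 2)
            (D.smul_mem_simpleCone (a := -c) (by linarith) (hγ 1))) ?_)
        have := hrec 0
        rw [neg_smul, ← this]
        abel
      · refine ih (fun n => γ (2 * n)) (c ^ 2 - 2) (fun n => hγ _) hγ0 (fun n => ?_) ?_ ?_
        · have h1 := hrec (2 * n)
          have h2 := hrec (2 * n + 1)
          have h3 := hrec (2 * n + 2)
          have e1 : γ (2 * (n + 2)) = c • γ (2 * n + 3) - γ (2 * n + 2) := eq_sub_of_add_eq h3
          have e2 : γ (2 * n + 3) = c • γ (2 * n + 2) - γ (2 * n + 1) := eq_sub_of_add_eq h2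
          have e3 : γ (2 * n) = c • γ (2 * n + 1) - γ (2 * n + 2) := eq_sub_of_add_eq' h1
          change γ (2 * (n + 2)) + γ (2 * n) = (c ^ 2 - 2) • γ (2 * n + 2)
          rw [e1, e2, e3]
          module
        · nlinarith
        · have hp : (0 : ℝ) < 2 ^ k := by positivity
          have : 2 * (2 - c) ≤ 2 - (c ^ 2 - 2) := by nlinarith
          calc (2 : ℝ) ≤ 2 ^ k * (2 * (2 - c)) := by rw [pow_succ] at hk; linarith
            _ ≤ _ := mul_le_mul_of_nonneg_left this hp.le
  by_contra! hc
  obtain ⟨k, hk⟩ := pow_unbounded_of_one_lt (2 / (2 - c)) (one_lt_two)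
  have h2c : 0 < 2 - c := by linarith
  rw [div_lt_iff₀ h2c] at hk
  exact key k γ c hγ hγ0 hrec hc hk.le

end Cone

/-- The coefficients of roots in a dihedral root system: `a 0 = 0`, `a 1 = 1`,
`a (k + 2) = c * a (k + 1) - a k`. -/
def dihedralCoeff (c : ℝ) : ℕ → ℝ
  | 0 => 0
  | 1 => 1
  | k + 2 => c * dihedralCoeff c (k + 1) - dihedralCoeff c k

theorem dihedralCoeff_nonneg_of_two_le {c : ℝ} (hc : 2 ≤ c) (k : ℕ) :
    0 ≤ dihedralCoeff c k ∧ dihedralCoeff c k ≤ dihedralCoeff c (k + 1) := by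
  induction k with
  | zero => simp [dihedralCoeff]
  | succ k ih =>
    refine ⟨ih.1.trans ih.2, ?_⟩
    simp only [dihedralCoeff]
    nlinarith [ih.1.trans ih.2]

theorem dihedralCoeff_mul_sin (θ : ℝ) (k : ℕ) :
    dihedralCoeff (2 * Real.cos θ) k * Real.sin θ = Real.sin (k * θ) ∧
    dihedralCoeff (2 * Real.cos θ) (k + 1) * Real.sin θ = Real.sin ((k + 1) * θ) := by
  induction k with
  | zero => simp [dihedralCoeff]
  | succ k ih =>
    refine ⟨by exact_mod_cast ih.2, ?_⟩
    have e1 : ((k + 1 : ℕ) + 1 : ℝ) * θ = (k + 1) * θ + θ := by push_cast; ring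
    have e2 : (k : ℝ) * θ = (k + 1) * θ - θ := by ring
    have h1 := ih.1
    rw [e2, Real.sin_sub] at h1
    rw [e1, Real.sin_add]
    simp only [dihedralCoeff]
    linear_combination (2 * Real.cos θ) * ih.2 - h1

/-! ### Positivity of the images of simple roots -/

section Representation

variable {I : Type*} {M : CoxeterMatrix I} {V : Type*} [AddCommGroup V] [Module ℝ V]
  (D : GeometricData M V) {W : Type*} [Group W] (cs : CoxeterSystem M W)

/-- For finite `m` the coefficient is `sin(kπ/m) / sin(π/m)`; for `m = ∞` the recurrence has factor
at least 2 and is non-decreasing. -/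
theorem dihedralCoeff_nonneg {i j : I} (hij : i ≠ j) (k : ℕ) (hk : M i j = 0 ∨ k ≤ M i j) :
    0 ≤ dihedralCoeff (-(2 * D.form (D.simpleRoot i) (D.simpleRoot j))) k := by
  by_cases h0 : M i j = 0
  · exact (dihedralCoeff_nonneg_of_two_le (by linarith [D.form_of_infinite i j h0]) k).1
  · have hk' : k ≤ M i j := hk.resolve_left h0
    have h1 := M.off_diagonal i j hij
    have h2 : (2 : ℝ) ≤ M i j := by exact_mod_cast (by omega : 2 ≤ M i j)
    have hkR : (k : ℝ) ≤ M i j := by exact_mod_cast hk'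
    rw [D.form_of_finite i j h0,
      show -(2 * -Real.cos (Real.pi / (M i j : ℝ))) = 2 * Real.cos (Real.pi / (M i j : ℝ)) by ring]
    have hs : 0 < Real.sin (Real.pi / (M i j : ℝ)) :=
      Real.sin_pos_of_pos_of_lt_pi (by positivity) (div_lt_self Real.pi_pos (by linarith))
    have hn : 0 ≤ Real.sin (k * (Real.pi / (M i j : ℝ))) := by
      apply Real.sin_nonneg_of_nonneg_of_le_pi (by positivity)
      rw [mul_div_assoc', div_le_iff₀ (by linarith), mul_comm]
      exact mul_le_mul_of_nonneg_left hkR Real.pi_pos.le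
    rw [← (dihedralCoeff_mul_sin _ k).1] at hn
    exact nonneg_of_mul_nonneg_left hn hs

theorem simpleReflection_self (i : I) :
    D.simpleReflection i (D.simpleRoot i) = -D.simpleRoot i := by
  rw [simpleReflection_apply, D.form_self]
  module

theorem form_comm (x y : V) : D.form x y = D.form y x := D.form_symm.eq _ _

theorem action_alternatingWord_concat (i j : I) (k : ℕ) (v : V) :
    D.action cs (cs.wordProd (CoxeterSystem.alternatingWord i j (k + 1))) v =
      D.action cs (cs.wordProd (CoxeterSystem.alternatingWord j i k)) (D.simpleReflection j v) := by
  rw [CoxeterSystem.alternatingWord_succ, cs.wordProd_concat, map_mul, action_simple]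
  rfl

theorem action_alternatingWord (k : ℕ) :
    ∀ i j : I, D.action cs (cs.wordProd (CoxeterSystem.alternatingWord i j k)) (D.simpleRoot i) =
      dihedralCoeff (-(2 * D.form (D.simpleRoot i) (D.simpleRoot j))) (k + 1) •
        D.simpleRoot (if Even k then i else j) +
      dihedralCoeff (-(2 * D.form (D.simpleRoot i) (D.simpleRoot j))) k •
        D.simpleRoot (if Even k then j else i) := by
  induction k using Nat.twoStepInduction with
  | zero => intro i j; simp [CoxeterSystem.alternatingWord, dihedralCoeff]
  | one =>
    intro i j
    rw [action_alternatingWord_concat]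
    simp only [CoxeterSystem.alternatingWord, cs.wordProd_nil, map_one, LinearEquiv.coe_one, id,
      simpleReflection_apply, Nat.not_even_one, if_false, dihedralCoeff,
      D.form_comm (D.simpleRoot j)]
    module
  | more k ih1 ih2 =>
    intro i j
    -- The last letter sends `α_i` to `α_i - 2 B(α_j, α_i) α_j`. On `α_j` the remaining word is
    -- covered by `ih2` with the letters swapped; on `α_i` it ends in `i`, so one letter only
    -- changes the sign and `ih1` applies.
    rw [action_alternatingWord_concat, simpleReflection_apply, map_sub, map_smul, ih2 j i,
      action_alternatingWord_concat, simpleReflection_self, map_neg, ih1 i j,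
      D.form_comm (D.simpleRoot j) (D.simpleRoot i)]
    have e : Even (k + 2) ↔ Even k := by simp [Nat.even_add]
    have e' : Even (k + 1) ↔ ¬ Even k := Nat.even_add_one
    simp only [e, e', dihedralCoeff]
    by_cases h : Even k <;> simp only [h, if_true, if_false, not_true, not_false_iff] <;> module

/-- If `w` has right descent `j`, one can strip from `w` a longest alternating word. -/
theorem exists_alternatingWord_factorization (i j : I) (w : W) :
    ∃ (v : W) (k : ℕ), w = v * cs.wordProd (CoxeterSystem.alternatingWord i j k) ∧
      cs.length w = cs.length v + k ∧
      ¬ cs.IsRightDescent v (if Even k then j else i) := by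
  induction hn : cs.length w using Nat.strong_induction_on generalizing w i j with
  | _ n ih =>
    by_cases hd : cs.IsRightDescent w j
    · have hl := (cs.isRightDescent_iff).1 hd
      obtain ⟨v, k, hv, hlen, hdesc⟩ := ih (cs.length (w * cs.simple j)) (by omega) j i _ rfl
      refine ⟨v, k + 1, ?_, by omega, ?_⟩
      · rw [CoxeterSystem.alternatingWord_succ, cs.wordProd_concat, ← mul_assoc, ← hv,
          cs.simple_mul_simple_cancel_right]
      · have e' : Even (k + 1) ↔ ¬ Even k := Nat.even_add_one
        by_cases h : Even k <;> simpa [e', h] using hdesc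
    · exact ⟨w, 0, by simp [CoxeterSystem.alternatingWord], by simp [hn], by simpa using hd⟩

theorem length_alternatingWord_le (i j : I) (k : ℕ) :
    cs.length (cs.wordProd (CoxeterSystem.alternatingWord i j k)) ≤ k :=
  (cs.length_wordProd_le _).trans (by simp)

/-- Strip from `w` a longest alternating word in `i` and a descent `j`. The remaining `v` is shorter
and has neither letter as a descent, so by induction it maps both simple roots into the cone; the
stripped word maps `α_i` to a non-negative combination of the two. -/
theorem action_simpleRoot_mem_simpleCone (w : W) (i : I) (h : ¬ cs.IsRightDescent w i) :
    D.action cs w (D.simpleRoot i) ∈ D.simpleCone := by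
  induction hn : cs.length w using Nat.strong_induction_on generalizing w i with
  | _ n ih =>
    by_cases hw : w = 1
    · subst hw; simpa using D.simpleRoot_mem_simpleCone i
    obtain ⟨j, hj⟩ := cs.exists_rightDescent_of_ne_one hw
    have hij : i ≠ j := by rintro rfl; exact h hj
    obtain ⟨v, k, hv, hlen, hdesc⟩ := exists_alternatingWord_factorization cs i j w
    have hk : k ≠ 0 := by
      rintro rfl
      simp [CoxeterSystem.alternatingWord] at hv hdesc
      exact hdesc (hv ▸ hj)
    obtain ⟨l, rfl⟩ := Nat.exists_eq_succ_of_ne_zero hk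
    -- This is the first letter of the stripped word: if it were a descent of `v`, absorbing it into
    -- `v` would make `w` too short.
    have hother : ¬ cs.IsRightDescent v (if Even (l + 1) then i else j) := by
      intro hd
      have h1 := (cs.isRightDescent_iff).1 hd
      have h2 : w = (v * cs.simple (if Even (l + 1) then i else j)) *
          cs.wordProd (CoxeterSystem.alternatingWord i j l) := by
        rw [hv, CoxeterSystem.alternatingWord_succ', cs.wordProd_cons]
        have e' : Even (l + 1) ↔ ¬ Even l := Nat.even_add_one
        by_cases h : Even l <;> simp [e', h, mul_assoc]
      have h3 := cs.length_mul_le (v * cs.simple (if Even (l + 1) then i else j))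
        (cs.wordProd (CoxeterSystem.alternatingWord i j l))
      rw [← h2] at h3
      have h4 := length_alternatingWord_le cs i j l
      omega
    have hvl : cs.length v < n := by omega
    have hvboth : D.action cs v (D.simpleRoot i) ∈ D.simpleCone ∧
        D.action cs v (D.simpleRoot j) ∈ D.simpleCone := by
      have h1 := ih _ hvl v _ hdesc rfl
      have h2 := ih _ hvl v _ hother rfl
      by_cases h : Even (l + 1)
      · simp only [h, if_true] at h1 h2
        exact ⟨h2, h1⟩
      · simp only [h, if_false] at h1 h2
        exact ⟨h1, h2⟩
    -- Otherwise the stripped word followed by `i` is longer than `m`, hence not reduced, and `w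
    -- s_i` would be shorter than `ℓ(w) + 1`.
    have hkm : M i j = 0 ∨ l + 2 ≤ M i j := by
      by_contra! hcon
      obtain ⟨h0, hlt⟩ := hcon
      have hnr := cs.not_isReduced_alternatingWord j i (m := l + 2)
        (by rwa [M.symmetric j i]) (by rw [M.symmetric j i]; omega)
      have hlt' : cs.length (cs.wordProd (CoxeterSystem.alternatingWord j i (l + 2))) < l + 2 :=
        lt_of_le_of_ne (length_alternatingWord_le cs j i _) (by
          simpa [CoxeterSystem.IsReduced] using hnr)
      have hws : w * cs.simple i =
          v * cs.wordProd (CoxeterSystem.alternatingWord j i (l + 2)) := by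
        rw [hv, mul_assoc, CoxeterSystem.alternatingWord_succ j i, cs.wordProd_concat]
      have h3 := cs.length_mul_le v (cs.wordProd (CoxeterSystem.alternatingWord j i (l + 2)))
      rw [← hws, (cs.not_isRightDescent_iff).1 h] at h3
      omega
    rw [hv, map_mul, LinearEquiv.mul_apply, D.action_alternatingWord, map_add, map_smul, map_smul]
    refine D.add_mem_simpleCone (D.smul_mem_simpleCone (D.dihedralCoeff_nonneg hij _ hkm) ?_)
      (D.smul_mem_simpleCone (D.dihedralCoeff_nonneg hij _ (hkm.imp_right (by omega))) ?_)
    · split_ifs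
      exacts [hvboth.1, hvboth.2]
    · split_ifs
      exacts [hvboth.2, hvboth.1]

end Representation

end GeometricData


namespace GeometricData

/-! ### Positive roots and inversion sets -/

section Roots

variable {I : Type*} {M : CoxeterMatrix I} {V : Type*} [AddCommGroup V] [Module ℝ V]
  (D : GeometricData M V) {W : Type*} [Group W] (cs : CoxeterSystem M W)

theorem action_mul_apply (x y : W) (v : V) :
    D.action cs (x * y) v = D.action cs x (D.action cs y v) := by
  rw [map_mul]; rfl

theorem action_inv_apply_self (x : W) (v : V) : D.action cs x⁻¹ (D.action cs x v) = v := by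
  rw [← action_mul_apply]; simp

theorem action_self_apply_inv (x : W) (v : V) : D.action cs x (D.action cs x⁻¹ v) = v := by
  rw [← action_mul_apply]; simp

theorem action_simple_self (i : I) :
    D.action cs (cs.simple i) (D.simpleRoot i) = -D.simpleRoot i := by
  rw [action_simple, simpleReflection_self]

theorem form_simpleReflection (i : I) (x y : V) :
    D.form (D.simpleReflection i x) (D.simpleReflection i y) = D.form x y := by
  simp only [simpleReflection_apply, map_sub, map_smul, LinearMap.sub_apply, LinearMap.smul_apply,
    smul_eq_mul, D.form_self, D.form_comm x (D.simpleRoot i)]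
  ring

theorem form_action (w : W) : ∀ x y : V,
    D.form (D.action cs w x) (D.action cs w y) = D.form x y := by
  induction w using cs.simple_induction_left with
  | one => simp
  | mul_simple_left w i ih =>
    intro x y
    rw [action_mul_apply, action_mul_apply, action_simple, form_simpleReflection, ih]

theorem simpleRoot_mem_roots (i : I) : D.simpleRoot i ∈ D.roots cs := ⟨1, i, by simp⟩

variable {D cs} in
theorem action_mem_roots {v : V} (hv : v ∈ D.roots cs) (w : W) :
    D.action cs w v ∈ D.roots cs := by
  obtain ⟨x, i, rfl⟩ := hv
  exact ⟨w * x, i, by rw [action_mul_apply]⟩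

variable {D cs} in
theorem neg_mem_roots {v : V} (hv : v ∈ D.roots cs) : -v ∈ D.roots cs := by
  obtain ⟨x, i, rfl⟩ := hv
  exact ⟨x * cs.simple i, i, by rw [action_mul_apply, action_simple_self, map_neg]⟩

variable {D cs} in
theorem form_self_of_mem_roots {v : V} (hv : v ∈ D.roots cs) : D.form v v = 1 := by
  obtain ⟨x, i, rfl⟩ := hv
  rw [form_action, D.form_self]

variable {D cs} in
theorem ne_zero_of_mem_roots {v : V} (hv : v ∈ D.roots cs) : v ≠ 0 := by
  rintro rfl
  simpa using form_self_of_mem_roots hv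

theorem simpleRoot_mem_posRoots (i : I) : D.simpleRoot i ∈ D.posRoots cs :=
  ⟨D.simpleRoot_mem_simpleCone i, D.simpleRoot_mem_roots cs i⟩

theorem action_simpleRoot_mem_negRoots {w : W} {i : I} (h : cs.IsRightDescent w i) :
    D.action cs w (D.simpleRoot i) ∈ D.negRoots cs := by
  have h1 := (cs.isRightDescent_iff_not_isRightDescent_mul).1 h
  have h2 := D.action_simpleRoot_mem_simpleCone cs _ i h1
  rw [action_mul_apply, action_simple_self, map_neg] at h2
  exact ⟨h2, neg_mem_roots ⟨w, i, rfl⟩⟩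

variable {D cs} in
theorem mem_posRoots_or_mem_negRoots {v : V} (hv : v ∈ D.roots cs) :
    v ∈ D.posRoots cs ∨ v ∈ D.negRoots cs := by
  obtain ⟨w, i, rfl⟩ := id hv
  by_cases h : cs.IsRightDescent w i
  · exact Or.inr (D.action_simpleRoot_mem_negRoots cs h)
  · exact Or.inl ⟨D.action_simpleRoot_mem_simpleCone cs w i h, hv⟩

variable {D cs} in
theorem notMem_negRoots {v : V} (hv : v ∈ D.posRoots cs) : v ∉ D.negRoots cs := fun h =>
  ne_zero_of_mem_roots hv.2 (D.eq_zero_of_neg_mem_simpleCone hv.1 h.1)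

variable {D cs} in
theorem mem_roots_of_mem_negRoots {v : V} (hv : v ∈ D.negRoots cs) : v ∈ D.roots cs := by
  simpa using neg_mem_roots hv.2

/-- A nontrivial element has a right descent and so makes a simple root negative. Identities in `W`
can therefore be checked on `V`. -/
theorem action_injective : Function.Injective (D.action cs) := by
  rw [injective_iff_map_eq_one]
  intro w hw
  by_contra hne
  obtain ⟨i, hi⟩ := cs.exists_rightDescent_of_ne_one hne
  have := D.action_simpleRoot_mem_negRoots cs hi
  rw [hw] at this
  exact notMem_negRoots (D.simpleRoot_mem_posRoots cs i) this

variable {D cs} in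
/-- Proportional positive roots are equal. -/
theorem eq_of_smul_eq {x y : V} (hx : x ∈ D.posRoots cs) (hy : y ∈ D.posRoots cs) {a : ℝ}
    (h : x = a • y) : x = y := by
  have h1 := form_self_of_mem_roots hx.2
  rw [h] at h1
  simp only [map_smul, LinearMap.smul_apply, smul_eq_mul, form_self_of_mem_roots hy.2] at h1
  have h2 : (a - 1) * (a + 1) = 0 := by linarith
  rcases mul_eq_zero.1 h2 with h3 | h3
  · rw [h, show a = 1 by linarith, one_smul]
  · exfalso
    refine notMem_negRoots hx ?_
    rw [h, show a = -1 by linarith, neg_one_smul]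
    simpa [negRoots] using hy

variable {D cs} in
/-- A simple reflection permutes the positive roots other than its own. -/
theorem action_simple_mem_posRoots {x : V} (hx : x ∈ D.posRoots cs) {i : I}
    (hne : x ≠ D.simpleRoot i) : D.action cs (cs.simple i) x ∈ D.posRoots cs := by
  refine (mem_posRoots_or_mem_negRoots (action_mem_roots hx.2 _)).resolve_right fun h => hne ?_
  have h1 := h.1
  rw [action_simple, simpleReflection_apply] at h1
  obtain ⟨b, hb⟩ := D.exists_smul_of_add_eq_smul hx.1 h1
    (i := i) (a := 2 * D.form (D.simpleRoot i) x) (by abel)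
  exact eq_of_smul_eq hx (D.simpleRoot_mem_posRoots cs i) hb

/-- A left factor `s_i` permutes the positive roots other than `α_i`, so it contributes at most one
new inversion. -/
theorem finite_inversionSet (w : W) : (D.inversionSet cs w).Finite := by
  induction w using cs.simple_induction_left with
  | one =>
    convert Set.finite_empty
    ext v
    simp only [inversionSet, inv_one, map_one, Set.mem_ofPred_eq, Set.mem_empty_iff_false,
      iff_false]
    exact fun h => notMem_negRoots h.1 h.2
  | mul_simple_left w i ih =>
    refine ((ih.image (D.action cs (cs.simple i))).insert (D.simpleRoot i)).subset ?_
    rintro v ⟨hv, hv'⟩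
    by_cases h : v = D.simpleRoot i
    · exact Or.inl h
    · refine Or.inr ⟨D.action cs (cs.simple i) v, ⟨action_simple_mem_posRoots hv h, ?_⟩, ?_⟩
      · rwa [mul_inv_rev, cs.inv_simple, action_mul_apply] at hv'
      · rw [← action_mul_apply]; simp

/-- If `w s_i` is longer than `w`, every inversion of `w` is one of `w s_i`. -/
theorem inversionSet_subset_mul_simple {w : W} {i : I} (h : ¬ cs.IsRightDescent w i) :
    D.inversionSet cs w ⊆ D.inversionSet cs (w * cs.simple i) := by
  rintro v ⟨hv, hv'⟩
  refine ⟨hv, ?_⟩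
  rw [mul_inv_rev, cs.inv_simple, action_mul_apply]
  change -D.action cs (cs.simple i) (D.action cs w⁻¹ v) ∈ D.posRoots cs
  rw [← map_neg]
  -- The exceptional case `-w⁻¹ v = α_i` would give `w α_i = -v`, although `w α_i` lies in the cone.
  refine action_simple_mem_posRoots hv' fun he => ?_
  have h1 := D.action_simpleRoot_mem_simpleCone cs w i h
  rw [← he, map_neg, action_self_apply_inv] at h1
  exact ne_zero_of_mem_roots hv.2 (D.eq_zero_of_neg_mem_simpleCone hv.1 h1)

theorem not_isRightDescent_of_isReduced_concat {ω : List I} {i : I}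
    (h : cs.IsReduced (ω ++ [i])) : ¬ cs.IsRightDescent (cs.wordProd ω) i := by
  have h1 : cs.IsReduced ω := by simpa using h.take ω.length
  have h2 := h.eq
  rw [cs.wordProd_append, cs.wordProd_singleton] at h2
  rw [cs.not_isRightDescent_iff, h2, h1.eq]
  simp

theorem inversionSet_subset_of_isReduced (ω ω' : List I) (h : cs.IsReduced (ω ++ ω')) :
    D.inversionSet cs (cs.wordProd ω) ⊆ D.inversionSet cs (cs.wordProd (ω ++ ω')) := by
  induction ω' using List.reverseRecOn with
  | nil => simp
  | append_singleton ω' i ih =>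
    rw [← List.append_assoc] at h ⊢
    have h1 : cs.IsReduced (ω ++ ω') := by
      simpa only [List.take_left'] using h.take (ω ++ ω').length
    refine (ih h1).trans ?_
    rw [cs.wordProd_append (ω ++ ω') [i], cs.wordProd_singleton]
    exact D.inversionSet_subset_mul_simple cs (not_isRightDescent_of_isReduced_concat cs h)

end Roots

/-! ### Root sequences of a pair of roots, and dominance -/

section Dihedral

variable {I : Type*} {M : CoxeterMatrix I} {V : Type*} [AddCommGroup V] [Module ℝ V]
  (D : GeometricData M V) {W : Type*} [Group W] (cs : CoxeterSystem M W)

/-- The sequence `α, β, ...` in which `γ (n + 2)` is the negative of the reflection of `γ n`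
in `γ (n + 1)`. -/
def rootSeq (α β : V) : ℕ → V
  | 0 => α
  | 1 => β
  | n + 2 => (2 * D.form α β) • rootSeq α β (n + 1) - rootSeq α β n

theorem rootSeq_add_two (α β : V) (n : ℕ) : D.rootSeq α β (n + 2) =
    (2 * D.form α β) • D.rootSeq α β (n + 1) - D.rootSeq α β n := rfl

variable {D cs} in
/-- The reflection in an arbitrary root is realized by a reflection of `W`. -/
theorem exists_isReflection {γ : V} (hγ : γ ∈ D.roots cs) :
    ∃ t, cs.IsReflection t ∧ ∀ v, D.action cs t v = v - (2 * D.form γ v) • γ := by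
  obtain ⟨w, i, rfl⟩ := hγ
  refine ⟨w * cs.simple i * w⁻¹, ⟨w, i, rfl⟩, fun v => ?_⟩
  have h : D.form (D.action cs w (D.simpleRoot i)) v =
      D.form (D.simpleRoot i) (D.action cs w⁻¹ v) := by
    rw [← D.form_action cs w (D.simpleRoot i), action_self_apply_inv]
  rw [action_mul_apply, action_mul_apply, action_simple, simpleReflection_apply, map_sub, map_smul,
    action_self_apply_inv, h]

variable {D cs} in
-- The recurrence has the fixed factor `2 B(α, β)`, so it is a reflection step only because
-- consecutive terms keep the same product; the claims have to be carried together.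
theorem rootSeq_mem_roots {α β : V} (hα : α ∈ D.roots cs) (hβ : β ∈ D.roots cs) (n : ℕ) :
    D.rootSeq α β n ∈ D.roots cs ∧ D.rootSeq α β (n + 1) ∈ D.roots cs ∧
      D.form (D.rootSeq α β n) (D.rootSeq α β (n + 1)) = D.form α β := by
  induction n with
  | zero => exact ⟨hα, hβ, rfl⟩
  | succ n ih =>
    obtain ⟨h1, h2, h3⟩ := ih
    refine ⟨h2, ?_, ?_⟩
    · obtain ⟨t, -, ht⟩ := exists_isReflection h2
      have := neg_mem_roots (action_mem_roots h1 t)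
      rw [ht, D.form_comm, h3, neg_sub] at this
      exact this
    · rw [rootSeq_add_two, map_sub, map_smul, form_self_of_mem_roots h2, D.form_comm _ (D.rootSeq α β n),
        h3, smul_eq_mul]
      ring

theorem action_rootSeq (w : W) (α β : V) (n : ℕ) :
    D.action cs w (D.rootSeq α β n) =
      D.rootSeq (D.action cs w α) (D.action cs w β) n := by
  induction n using Nat.twoStepInduction with
  | zero => rfl
  | one => rfl
  | more n h1 h2 => rw [rootSeq_add_two, rootSeq_add_two, map_sub, map_smul, h1, h2, form_action]

theorem rootSeq_neg (α β : V) (n : ℕ) : D.rootSeq (-α) (-β) n = -D.rootSeq α β n := by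
  induction n using Nat.twoStepInduction with
  | zero => rfl
  | one => rfl
  | more n h1 h2 =>
    rw [rootSeq_add_two, rootSeq_add_two, h1, h2]
    simp only [map_neg, LinearMap.neg_apply, neg_neg]
    module

variable {D cs} in
/-- If `-α` and `β` are positive with `B(α, β) ≥ 1`, the sequence increases from `β` on. -/
theorem rootSeq_increasing {α β : V} (hα : α ∈ D.negRoots cs) (hβ : β ∈ D.posRoots cs)
    (h : 1 ≤ D.form α β) (n : ℕ) : D.rootSeq α β (n + 1) ∈ D.posRoots cs ∧
      D.rootSeq α β (n + 1) - D.rootSeq α β n ∈ D.simpleCone := by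
  induction n with
  | zero =>
    refine ⟨hβ, ?_⟩
    change β - α ∈ _
    rw [sub_eq_add_neg]
    exact D.add_mem_simpleCone hβ.1 hα.1
  | succ n ih =>
    have h1 : D.rootSeq α β (n + 2) - D.rootSeq α β (n + 1) ∈ D.simpleCone := by
      have e : D.rootSeq α β (n + 2) - D.rootSeq α β (n + 1) =
          (2 * D.form α β - 2) • D.rootSeq α β (n + 1) +
            (D.rootSeq α β (n + 1) - D.rootSeq α β n) := by
        rw [rootSeq_add_two]; module
      rw [e]
      exact D.add_mem_simpleCone (D.smul_mem_simpleCone (by linarith) ih.1.1) ih.2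
    refine ⟨⟨?_, (rootSeq_mem_roots (mem_roots_of_mem_negRoots hα) hβ.2 (n + 1)).2.1⟩, h1⟩
    have := D.add_mem_simpleCone h1 ih.1.1
    rwa [sub_add_cancel] at this

variable {D cs} in
-- All increments lie in a pointed cone, so a repetition forces some increment to vanish. A
-- vanishing increment makes the preceding one vanish, back to `β = α`, which have opposite signs.
theorem rootSeq_injective {α β : V} (hα : α ∈ D.negRoots cs) (hβ : β ∈ D.posRoots cs)
    (h : 1 ≤ D.form α β) : Function.Injective (D.rootSeq α β) := by
  have hcone : ∀ n k, D.rootSeq α β (n + 1 + k) - D.rootSeq α β (n + 1) ∈ D.simpleCone := by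
    intro n k
    induction k with
    | zero => simpa using D.zero_mem_simpleCone
    | succ k ih =>
      have h1 := (rootSeq_increasing hα hβ h (n + 1 + k)).2
      have := D.add_mem_simpleCone h1 ih
      rwa [sub_add_sub_cancel] at this
  have hsucc : ∀ n, D.rootSeq α β (n + 1) ≠ D.rootSeq α β n := by
    intro n
    induction n with
    | zero =>
      intro he
      change β = α at he
      exact notMem_negRoots hβ (he ▸ hα)
    | succ n ih =>
      intro he
      have hn := rootSeq_increasing hα hβ h n
      have e : (2 * D.form α β - 2) • D.rootSeq α β (n + 1) +
            (D.rootSeq α β (n + 1) - D.rootSeq α β n) = 0 := by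
        rw [rootSeq_add_two, sub_eq_iff_eq_add] at he
        have : D.rootSeq α β n = (2 * D.form α β) • D.rootSeq α β (n + 1) -
          D.rootSeq α β (n + 1) := by rw [he]; abel
        rw [this]; module
      rw [add_comm] at e
      exact ih (sub_eq_zero.1 (D.eq_zero_of_add_eq_zero hn.2
        (D.smul_mem_simpleCone (by linarith) hn.1.1) e))
  have hlt : ∀ m n, m < n → D.rootSeq α β m ≠ D.rootSeq α β n := by
    intro m n hmn he
    obtain ⟨k, rfl⟩ := Nat.exists_eq_add_of_lt hmn
    rw [show m + k + 1 = m + 1 + k by ring] at he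
    refine hsucc m (sub_eq_zero.1 (D.eq_zero_of_neg_mem_simpleCone
      (rootSeq_increasing hα hβ h m).2 ?_))
    have := hcone m k
    rw [← he] at this
    simpa using this
  intro m n he
  rcases lt_trichotomy m n with h1 | h1 | h1
  · exact absurd he (hlt _ _ h1)
  · exact h1
  · exact absurd he.symm (hlt _ _ h1)

variable {D cs} in
theorem one_le_form_of_domLE {α β : V} (hα : α ∈ D.posRoots cs) (hβ : β ∈ D.posRoots cs)
    (h : D.DomLE cs α β) : 1 ≤ D.form α β := by
  -- dominance, extended to all roots, is invariant under `W`
  have key : ∀ n (w : W), D.action cs w (D.rootSeq α β n) ∈ D.posRoots cs →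
      D.action cs w (D.rootSeq α β (n + 1)) ∈ D.posRoots cs := by
    intro n
    induction n with
    | zero =>
      intro w hw
      change D.action cs w β ∈ _
      refine (mem_posRoots_or_mem_negRoots (action_mem_roots hβ.2 w)).resolve_right fun hn => ?_
      have := (h w⁻¹ ⟨hβ, by rwa [inv_inv]⟩).2
      rw [inv_inv] at this
      exact notMem_negRoots hw this
    | succ n ih =>
      intro w hw
      obtain ⟨h1, h2, h3⟩ := rootSeq_mem_roots hα.2 hβ.2 n
      have h4 := (rootSeq_mem_roots hα.2 hβ.2 (n + 1)).2.1
      obtain ⟨t, -, ht⟩ := exists_isReflection h2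
      -- Reflection in `γ (n + 1)` turns `(γ n, γ (n + 1))` into `(-γ (n + 2), -γ (n + 1))`, and
      -- negation reverses the implication between signs.
      have e1 : D.action cs t (D.rootSeq α β n) = -D.rootSeq α β (n + 2) := by
        rw [ht, D.form_comm, h3, rootSeq_add_two, neg_sub]
      have e2 : D.action cs t (D.rootSeq α β (n + 1)) = -D.rootSeq α β (n + 1) := by
        rw [ht, form_self_of_mem_roots h2]; module
      refine (mem_posRoots_or_mem_negRoots (action_mem_roots h4 w)).resolve_right fun hn => ?_
      have h5 := ih (w * t) (by rw [action_mul_apply, e1, map_neg]; exact hn)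
      rw [action_mul_apply, e2, map_neg] at h5
      exact notMem_negRoots hw h5
  have hpos : ∀ n, D.rootSeq α β n ∈ D.posRoots cs := by
    intro n
    induction n with
    | zero => exact hα
    | succ n ih => simpa using key n 1 (by simpa using ih)
  have := D.two_le_of_recurrence (γ := D.rootSeq α β) (c := 2 * D.form α β) (fun n => (hpos n).1)
    (ne_zero_of_mem_roots hα.2) fun n => by rw [rootSeq_add_two, sub_add_cancel]
  linarith

variable {D cs} in
/-- If `B(α, β) ≥ 1` and some `u` has `α`, but not `β`, as an inversion, then `β`
dominates `α`. -/
theorem domLE_of_one_le_form {α β : V} (hα : α ∈ D.posRoots cs)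
    (h : 1 ≤ D.form α β) {u : W} (hu : D.action cs u⁻¹ α ∈ D.negRoots cs)
    (hu' : D.action cs u⁻¹ β ∈ D.posRoots cs) : D.DomLE cs α β := by
  intro w hw
  -- Suppose `w` inverts `β` but not `α`. Under `u⁻¹` the sequence is positive from index 1 on (at
  -- index 0 it is negative, hence the shift below); under `w⁻¹` its negative is. So the `u⁻¹ γ (n +
  -- 1)` are infinitely many inversions of `u⁻¹ w`.
  refine ⟨hα, (mem_posRoots_or_mem_negRoots (action_mem_roots hα.2 _)).resolve_left fun hn => ?_⟩
  have hβ := hw.2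
  have hinj := rootSeq_injective hu hu' (by rwa [form_action])
  have hpos := rootSeq_increasing hu hu' (by rwa [form_action])
  have hneg := rootSeq_increasing (α := -D.action cs w⁻¹ α) (β := -D.action cs w⁻¹ β)
    (by simpa [negRoots] using hn) hβ (by simpa only [map_neg, LinearMap.neg_apply, neg_neg, form_action] using h)
  refine Set.infinite_of_injective_forall_mem (f := fun n => D.rootSeq (D.action cs u⁻¹ α)
    (D.action cs u⁻¹ β) (n + 1)) (fun m n hmn => by simpa using hinj hmn) (fun n => ?_)
    (D.finite_inversionSet cs (u⁻¹ * w))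
  refine ⟨(hpos n).1, ?_⟩
  have hmem := (hneg n).1
  rw [rootSeq_neg, ← action_rootSeq] at hmem
  rw [← action_rootSeq, mul_inv_rev, inv_inv, action_mul_apply, action_self_apply_inv]
  exact hmem

/-- The linear map `t s` respects the recurrence, so the shift by two need only be checked on the
first two terms. -/
theorem action_mul_rootSeq {α β : V} {s t : W} (hα : D.form α α = 1) (hβ : D.form β β = 1)
    (hs : ∀ v, D.action cs s v = v - (2 * D.form α v) • α)
    (ht : ∀ v, D.action cs t v = v - (2 * D.form β v) • β) (n : ℕ) :
    D.action cs (t * s) (D.rootSeq α β n) = D.rootSeq α β (n + 2) := by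
  induction n using Nat.twoStepInduction with
  | zero =>
    change D.action cs (t * s) α = (2 * D.form α β) • β - α
    rw [action_mul_apply, hs, hα, map_sub, map_smul, ht, D.form_comm β]
    module
  | one =>
    change D.action cs (t * s) β = (2 * D.form α β) • ((2 * D.form α β) • β - α) - β
    rw [action_mul_apply, hs, map_sub, map_smul, ht, ht, hβ, D.form_comm β α]
    module
  | more n h1 h2 =>
    rw [rootSeq_add_two, map_sub, map_smul, h1, h2, ← rootSeq_add_two]

theorem action_mul_pow_rootSeq {α β : V} {s t : W} (hα : D.form α α = 1) (hβ : D.form β β = 1)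
    (hs : ∀ v, D.action cs s v = v - (2 * D.form α v) • α)
    (ht : ∀ v, D.action cs t v = v - (2 * D.form β v) • β) (k n : ℕ) :
    D.action cs ((t * s) ^ k) (D.rootSeq α β n) = D.rootSeq α β (n + 2 * k) := by
  induction k with
  | zero => simp
  | succ k ih =>
    rw [pow_succ', action_mul_apply, ih, D.action_mul_rootSeq cs hα hβ hs ht]
    rfl

end Dihedral

end GeometricData

/-- Two involutions generate an infinite group exactly if their product has infinite order. -/
theorem infinite_closure_pair_iff {G : Type*} [Group G] {s t : G} (hs : s * s = 1)
    (ht : t * t = 1) : Infinite (Subgroup.closure {s, t}) ↔ ¬ IsOfFinOrder (t * s) := by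
  have hs' : s⁻¹ = s := inv_eq_of_mul_eq_one_left hs
  have ht' : t⁻¹ = t := inv_eq_of_mul_eq_one_left ht
  constructor
  · intro hinf hfin
    have hz : (Subgroup.zpowers (t * s) : Set G).Finite := hfin.finite_zpowers
    -- Conjugation by `s` inverts `t s`, so the powers of `t s` and their translates by `s` already
    -- form a group.
    have hsub : (Subgroup.closure {s, t} : Set G) ⊆
        (Subgroup.zpowers (t * s) : Set G) ∪ (fun g => g * s) '' (Subgroup.zpowers (t * s)) := by
      intro g hg
      have conj : ∀ x ∈ Subgroup.zpowers (t * s), s * x * s ∈ Subgroup.zpowers (t * s) := by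
        rintro _ ⟨n, rfl⟩
        have e : s * (t * s) ^ n * s = s * (t * s) ^ n * s⁻¹ := by rw [hs']
        have e2 : s * (t * s) * s⁻¹ = (t * s)⁻¹ := by rw [mul_inv_rev, hs', ht']; simp [mul_assoc, hs]
        change s * (t * s) ^ n * s ∈ _
        rw [e, ← conj_zpow, e2]
        exact Subgroup.zpow_mem _ (Subgroup.inv_mem _ (Subgroup.mem_zpowers _)) _
      have mem : g ∈ Subgroup.zpowers (t * s) ∨ g * s ∈ Subgroup.zpowers (t * s) := by
        induction hg using Subgroup.closure_induction with
        | mem x hx =>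
          rcases hx with rfl | rfl
          · right; rw [hs]; exact Subgroup.one_mem _
          · right; exact Subgroup.mem_zpowers _
        | one => left; exact Subgroup.one_mem _
        | mul x y _ _ hx hy =>
          rcases hx with hx | hx <;> rcases hy with hy | hy
          · left; exact Subgroup.mul_mem _ hx hy
          · right; rw [mul_assoc]; exact Subgroup.mul_mem _ hx hy
          · right
            have := Subgroup.mul_mem _ hx (conj y hy)
            rwa [show x * s * (s * y * s) = x * (s * s) * y * s by group, hs, mul_one] at this
          · left
            have := Subgroup.mul_mem _ hx (conj _ hy)
            rwa [show x * s * (s * (y * s) * s) = x * (s * s) * y * (s * s) by group, hs, mul_one,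
              mul_one] at this
        | inv x _ hx =>
          rcases hx with hx | hx
          · left; exact Subgroup.inv_mem _ hx
          · right
            have := conj _ (Subgroup.inv_mem _ hx)
            rwa [mul_inv_rev, hs', ← mul_assoc, hs, one_mul] at this
      rcases mem with h | h
      · exact Or.inl h
      · exact Or.inr ⟨g * s, h, by simp [mul_assoc, hs]⟩
    have := (hz.union (hz.image _)).subset hsub
    exact this.not_infinite (Set.infinite_coe_iff.1 hinf)
  · intro h
    have hmem : t * s ∈ Subgroup.closure {s, t} :=
      Subgroup.mul_mem _ (Subgroup.subset_closure (by simp)) (Subgroup.subset_closure (by simp))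
    refine Infinite.of_injective (fun n : ℕ => (⟨(t * s) ^ n, Subgroup.pow_mem _ hmem n⟩ :
      Subgroup.closure {s, t})) fun m n hmn => ?_
    exact injective_pow_iff_not_isOfFinOrder.2 h (congrArg Subtype.val hmn)

namespace GeometricData

/-! ### Infinite dihedral reflection subgroups -/

section Infinite

variable {I : Type*} {M : CoxeterMatrix I} {V : Type*} [AddCommGroup V] [Module ℝ V]
  {D : GeometricData M V} {W : Type*} [Group W] {cs : CoxeterSystem M W}

theorem IsRootOf.eq_of_root_eq {s t : W} {α : V} (hs : D.IsRootOf cs s α)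
    (ht : D.IsRootOf cs t α) : s = t :=
  D.action_injective cs (LinearEquiv.ext fun v => by rw [hs.2.2, ht.2.2])

/-- A trivial power of `t s` would make the root sequence repeat, but its translate by `u⁻¹` is
injective. -/
theorem infinite_closure_of_one_le_form {α β : V} {s t u : W} (hs : D.IsRootOf cs s α)
    (ht : D.IsRootOf cs t β) (h : 1 ≤ D.form α β) (hu : D.action cs u⁻¹ α ∈ D.negRoots cs)
    (hu' : D.action cs u⁻¹ β ∈ D.posRoots cs) : Infinite (Subgroup.closure {s, t}) := by
  rw [infinite_closure_pair_iff hs.1.mul_self ht.1.mul_self, isOfFinOrder_iff_pow_eq_one]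
  rintro ⟨n, hn, hpow⟩
  have hinj := rootSeq_injective hu hu' (by rwa [form_action])
  have h1 := D.action_mul_pow_rootSeq cs (form_self_of_mem_roots hs.2.1.2)
    (form_self_of_mem_roots ht.2.1.2) hs.2.2 ht.2.2 n 0
  rw [hpow, map_one] at h1
  have h2 := congrArg (D.action cs u⁻¹) h1
  simp only [LinearEquiv.coe_one, id, action_rootSeq] at h2
  have := hinj h2
  omega

theorem IsRootOf.commute_of_action_eq {s x : W} {α : V} (hs : D.IsRootOf cs s α)
    (hx : D.action cs x α = α) : x * s = s * x := by
  refine D.action_injective cs (LinearEquiv.ext fun v => ?_)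
  have h : D.form α (D.action cs x v) = D.form α v := by
    conv_lhs => rw [← hx]
    exact D.form_action cs x α v
  rw [action_mul_apply, action_mul_apply, hs.2.2, hs.2.2, map_sub, map_smul, hx, h]

/-- A repetition gives a power of `t s` fixing `α`, hence commuting with `s`. But `s` also inverts
it, so its square is 1 and `t s` has finite order. Nothing about `B(α, β)` is needed. -/
theorem rootSeq_even_injective {α β : V} {s t : W} (hs : D.IsRootOf cs s α)
    (ht : D.IsRootOf cs t β) (h : ¬ IsOfFinOrder (t * s)) :
    Function.Injective fun k => D.rootSeq α β (2 * k) := by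
  have hpow : ∀ k, D.action cs ((t * s) ^ k) α = D.rootSeq α β (2 * k) := fun k => by
    have := D.action_mul_pow_rootSeq cs (form_self_of_mem_roots hs.2.1.2)
      (form_self_of_mem_roots ht.2.1.2) hs.2.2 ht.2.2 k 0
    rwa [zero_add] at this
  have hlt : ∀ m k, D.rootSeq α β (2 * m) = D.rootSeq α β (2 * (m + k)) → k = 0 := by
    intro m k he
    by_contra hk
    rw [← hpow, ← hpow, pow_add, action_mul_apply] at he
    have hcomm := hs.commute_of_action_eq ((D.action cs _).injective he).symm
    have hinv : s * (t * s) ^ k * s⁻¹ = ((t * s) ^ k)⁻¹ := by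
      rw [← conj_pow, ← inv_pow]
      congr 1
      rw [mul_inv_rev, hs.1.inv, ht.1.inv, mul_assoc, mul_assoc, hs.1.mul_self, mul_one]
    rw [← hcomm, mul_inv_cancel_right, eq_inv_iff_mul_eq_one, ← pow_add] at hinv
    exact h (isOfFinOrder_iff_pow_eq_one.2 ⟨k + k, by omega, hinv⟩)
  intro m n he
  rcases le_total m n with h1 | h1
  · obtain ⟨k, rfl⟩ := Nat.exists_eq_add_of_le h1
    have := hlt _ _ he
    omega
  · obtain ⟨k, rfl⟩ := Nat.exists_eq_add_of_le h1
    have := hlt _ _ he.symm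
    omega

/-- Two roots whose reflections generate an infinite group do not span a definite plane. -/
theorem one_le_form_sq_of_infinite_closure {α β : V} {s t : W} (hs : D.IsRootOf cs s α)
    (ht : D.IsRootOf cs t β) (h : Infinite (Subgroup.closure {s, t})) :
    1 ≤ D.form α β ^ 2 := by
  rw [infinite_closure_pair_iff hs.1.mul_self ht.1.mul_self] at h
  have hinj := rootSeq_even_injective hs ht h
  have hroot : ∀ n, D.rootSeq α β n ∈ D.roots cs :=
    fun n => (rootSeq_mem_roots hs.2.1.2 ht.2.1.2 n).1
  -- Each change of sign from plus to minus yields an inversion of `(t s)⁻¹`, a different one for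
  -- each `k`.
  have hfin : {k | D.rootSeq α β (2 * k) ∈ D.posRoots cs ∧
      D.rootSeq α β (2 * (k + 1)) ∈ D.negRoots cs}.Finite := by
    refine Set.Finite.of_finite_image (f := fun k => D.rootSeq α β (2 * k))
      ((D.finite_inversionSet cs (t * s)⁻¹).subset ?_) hinj.injOn
    rintro _ ⟨k, ⟨h1, h2⟩, rfl⟩
    refine ⟨h1, ?_⟩
    rwa [inv_inv, D.action_mul_rootSeq cs (form_self_of_mem_roots hs.2.1.2)
      (form_self_of_mem_roots ht.2.1.2) hs.2.2 ht.2.2]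
  obtain ⟨K, hK⟩ := hfin.bddAbove
  have hstep : ∀ k, K < k → D.rootSeq α β (2 * k) ∈ D.posRoots cs →
      D.rootSeq α β (2 * (k + 1)) ∈ D.posRoots cs := fun k hk hpos =>
    (mem_posRoots_or_mem_negRoots (hroot _)).resolve_right fun hneg =>
      absurd (hK ⟨hpos, hneg⟩) (by omega)
  have hrec : ∀ k, D.rootSeq α β (2 * (k + 2)) + D.rootSeq α β (2 * k) =
      ((2 * D.form α β) ^ 2 - 2) • D.rootSeq α β (2 * (k + 1)) := by
    intro k
    have e1 : D.rootSeq α β (2 * (k + 2)) = (2 * D.form α β) • D.rootSeq α β (2 * k + 3) -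
        D.rootSeq α β (2 * k + 2) := rfl
    have e2 : D.rootSeq α β (2 * k + 3) = (2 * D.form α β) • D.rootSeq α β (2 * k + 2) -
        D.rootSeq α β (2 * k + 1) := rfl
    have e3 : D.rootSeq α β (2 * k) = (2 * D.form α β) • D.rootSeq α β (2 * k + 1) -
        D.rootSeq α β (2 * k + 2) := by rw [rootSeq_add_two]; abel
    change _ = ((2 * D.form α β) ^ 2 - 2) • D.rootSeq α β (2 * k + 2)
    rw [e1, e2, e3]
    module
  have hc : 2 ≤ (2 * D.form α β) ^ 2 - 2 := by
    -- Past `K` a positive term stays positive forever. If there is none, all terms are negative and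
    -- the negated tail lies in the cone.
    by_cases hex : ∃ k, K < k ∧ D.rootSeq α β (2 * k) ∈ D.posRoots cs
    · obtain ⟨k, hk, hpos⟩ := hex
      have hall : ∀ n, D.rootSeq α β (2 * (k + n)) ∈ D.posRoots cs := by
        intro n
        induction n with
        | zero => exact hpos
        | succ n ih => exact hstep (k + n) (by omega) ih
      exact D.two_le_of_recurrence (γ := fun n => D.rootSeq α β (2 * (k + n)))
        (fun n => (hall n).1) (ne_zero_of_mem_roots (hroot _)) fun n => hrec (k + n)
    · push Not at hex
      have hall : ∀ n, -D.rootSeq α β (2 * (K + 1 + n)) ∈ D.simpleCone := fun n =>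
        ((mem_posRoots_or_mem_negRoots (hroot _)).resolve_left (hex (K + 1 + n) (by omega))).1
      refine D.two_le_of_recurrence (γ := fun n => -D.rootSeq α β (2 * (K + 1 + n)))
        hall (neg_ne_zero.2 (ne_zero_of_mem_roots (hroot _))) fun n => ?_
      rw [smul_neg, ← neg_add, ← add_assoc]
      exact congrArg Neg.neg (hrec (K + 1 + n))
  linarith [mul_pow 2 (D.form α β) 2]

end Infinite

/-! ### Inversions of a reflection prefix -/

section Prefix

variable {I : Type*} {M : CoxeterMatrix I} {V : Type*} [AddCommGroup V] [Module ℝ V]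
  {D : GeometricData M V} {W : Type*} [Group W] {cs : CoxeterSystem M W}

/-- A `t`-prefix is `u s_r`, where `β = u(α_r)` is the root of `t` and all inversions of `u` are
inversions of `t`. -/
theorem IsRootOf.exists_prefix_factorization {β : V} {t p : W} (ht : D.IsRootOf cs t β)
    (hp : IsReflectionPrefix cs t p) : ∃ (u : W) (r : I), p = u * cs.simple r ∧
      β = D.action cs u (D.simpleRoot r) ∧ D.inversionSet cs u ⊆ D.inversionSet cs t := by
  obtain ⟨-, hne, hp⟩ := hp
  obtain ⟨ω', hred, rfl⟩ := cs.exists_isReduced p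
  rcases List.eq_nil_or_concat ω' with rfl | ⟨ω, r, rfl⟩
  · simp at hne
  rw [List.concat_eq_append] at hred hp ⊢
  obtain ⟨hpal, hprod⟩ := hp ω r hred rfl
  refine ⟨cs.wordProd ω, r, by rw [cs.wordProd_append, cs.wordProd_singleton], ?_, ?_⟩
  · have hpos : D.action cs (cs.wordProd ω) (D.simpleRoot r) ∈ D.posRoots cs :=
      ⟨D.action_simpleRoot_mem_simpleCone cs _ _ (not_isRightDescent_of_isReduced_concat cs hred),
        ⟨_, _, rfl⟩⟩
    have h1 : D.action cs t β = -β := by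
      rw [ht.2.2, form_self_of_mem_roots ht.2.1.2]; module
    -- Both `β` and `u(α_r)` are negated by the reflection `t`, so they are proportional positive
    -- roots.
    have h2 : D.action cs t (D.action cs (cs.wordProd ω) (D.simpleRoot r)) =
        -D.action cs (cs.wordProd ω) (D.simpleRoot r) := by
      rw [← hprod, cs.wordProd_append, cs.wordProd_cons, cs.wordProd_reverse, action_mul_apply,
        action_mul_apply, action_inv_apply_self, action_simple_self, map_neg]
    rw [ht.2.2] at h2
    refine (eq_of_smul_eq hpos ht.2.1
      (a := D.form β (D.action cs (cs.wordProd ω) (D.simpleRoot r))) ?_).symm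
    generalize D.action cs (cs.wordProd ω) (D.simpleRoot r) = x at h2 ⊢
    have h3 : (2 : ℝ) • x = (2 : ℝ) • (D.form β x • β) := by
      rw [sub_eq_iff_eq_add] at h2
      rw [smul_smul, two_smul]
      nth_rw 1 [h2]
      abel
    exact smul_right_injective V (two_ne_zero (α := ℝ)) h3
  · rw [← hprod]
    exact D.inversionSet_subset_of_isReduced cs _ _ hpal

/-- If `u⁻¹ α` were positive, it would differ from `α_r` and `s_r` would keep it positive. Thus `u`
separates `α` from `β`, as the dominance criterion requires. -/
theorem action_inv_mem_negRoots_of_prefix {u : W} {r : I} {α : V} (hα : α ∈ D.posRoots cs)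
    (hne : α ≠ D.action cs u (D.simpleRoot r))
    (h : α ∈ D.inversionSet cs (u * cs.simple r)) : D.action cs u⁻¹ α ∈ D.negRoots cs := by
  refine (mem_posRoots_or_mem_negRoots (action_mem_roots hα.2 _)).resolve_left fun hpos => ?_
  have h1 := action_simple_mem_posRoots hpos (i := r) fun he =>
    hne (by rw [← he, action_self_apply_inv])
  have h2 := h.2
  rw [mul_inv_rev, cs.inv_simple, action_mul_apply] at h2
  exact notMem_negRoots h1 h2

end Prefix

end GeometricData

/-! ### The dominance set of a root -/

theorem mainTheorem9 {I W V : Type*} [Group W] [AddCommGroup V] [Module ℝ V]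
    {M : CoxeterMatrix I} (cs : CoxeterSystem M W) (D : GeometricData M V)
    (β : V) (hβ : β ∈ D.posRoots cs) (t : W) (ht : D.IsRootOf cs t β)
    (p : W) (hp : IsReflectionPrefix cs t p) :
    D.Dom cs β = {α | α ∈ D.inversionSet cs p ∧ 1 ≤ D.form α β} ∧
    D.Dom cs β = {β} ∪ {α | α ∈ D.inversionSet cs p ∧
      ∃ s : W, D.IsRootOf cs s α ∧ Infinite (Subgroup.closure {s, t})} ∧
    Disjoint {β} {α | α ∈ D.inversionSet cs p ∧
      ∃ s : W, D.IsRootOf cs s α ∧ Infinite (Subgroup.closure {s, t})} ∧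
    D.dpInf cs β = {α | α ∈ D.inversionSet cs p ∧
      ∃ s : W, D.IsRootOf cs s α ∧ Infinite (Subgroup.closure {s, t})}.encard := by
  obtain ⟨u, r, hpu, hβu, hut⟩ := ht.exists_prefix_factorization hp
  have hu' : D.action cs u⁻¹ β ∈ D.posRoots cs := by
    rw [hβu, D.action_inv_apply_self]
    exact D.simpleRoot_mem_posRoots cs r
  have hβp : β ∈ D.inversionSet cs p := by
    refine ⟨hβ, ?_⟩
    rw [hpu, mul_inv_rev, cs.inv_simple, D.action_mul_apply, hβu, D.action_inv_apply_self,
      D.action_simple_self]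
    change - -_ ∈ D.posRoots cs
    rw [neg_neg]
    exact D.simpleRoot_mem_posRoots cs r
  have hu : ∀ α ∈ D.inversionSet cs p, α ≠ β → D.action cs u⁻¹ α ∈ D.negRoots cs :=
    fun α hα hne => GeometricData.action_inv_mem_negRoots_of_prefix hα.1 (hβu ▸ hne) (hpu ▸ hα)
  have h1 : D.Dom cs β = {α | α ∈ D.inversionSet cs p ∧ 1 ≤ D.form α β} := by
    ext α
    constructor
    · rintro ⟨hα, hdom⟩
      exact ⟨hdom p hβp, GeometricData.one_le_form_of_domLE hα hβ hdom⟩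
    · rintro ⟨hα, hB⟩
      refine ⟨hα.1, ?_⟩
      by_cases hne : α = β
      · exact fun w hw => hne ▸ hw
      · exact GeometricData.domLE_of_one_le_form hα.1 hB (hu α hα hne) hu'
  have h3 : Disjoint {β} {α | α ∈ D.inversionSet cs p ∧
      ∃ s : W, D.IsRootOf cs s α ∧ Infinite (Subgroup.closure {s, t})} := by
    rw [Set.disjoint_singleton_left]
    rintro ⟨-, s, hs, hinf⟩
    obtain rfl := hs.eq_of_root_eq ht
    rw [infinite_closure_pair_iff hs.1.mul_self hs.1.mul_self, hs.1.mul_self] at hinf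
    exact hinf IsOfFinOrder.one
  have h2 : D.Dom cs β = {β} ∪ {α | α ∈ D.inversionSet cs p ∧
      ∃ s : W, D.IsRootOf cs s α ∧ Infinite (Subgroup.closure {s, t})} := by
    rw [h1]
    ext α
    constructor
    · rintro ⟨hα, hB⟩
      by_cases hne : α = β
      · exact Or.inl hne
      · obtain ⟨s, hs, hsα⟩ := GeometricData.exists_isReflection hα.1.2
        have hroot : D.IsRootOf cs s α := ⟨hs, hα.1, hsα⟩
        exact Or.inr ⟨hα, s, hroot, GeometricData.infinite_closure_of_one_le_form hroot ht hB
          (hu α hα hne) hu'⟩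
    · rintro (rfl | ⟨hα, s, hs, hinf⟩)
      · exact ⟨hβp, (GeometricData.form_self_of_mem_roots hβ.2).ge⟩
      · refine ⟨hα, ?_⟩
        have hne : α ≠ β := by
          rintro rfl
          exact Set.disjoint_singleton_left.1 h3 ⟨hα, s, hs, hinf⟩
        have hsq := GeometricData.one_le_form_sq_of_infinite_closure hs ht hinf
        -- By `Φ(u) ⊆ Φ(t)` the root `t α = α - 2 B(α, β) β` is negative, while `B(α, β) < 0` would
        -- put it in the cone.
        have hpos : 0 ≤ D.form α β := by
          by_contra! hneg
          have hαt := (hut ⟨hα.1, hu α hα hne⟩).2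
          rw [ht.1.inv, ht.2.2, D.form_comm β α] at hαt
          refine GeometricData.ne_zero_of_mem_roots
            (GeometricData.mem_roots_of_mem_negRoots hαt)
            (D.eq_zero_of_neg_mem_simpleCone ?_ hαt.1)
          rw [sub_eq_add_neg, ← neg_smul]
          exact D.add_mem_simpleCone hα.1.1 (D.smul_mem_simpleCone (by linarith) hβ.1)
        exact (one_le_sq_iff₀ hpos).1 hsq
  refine ⟨h1, h2, h3, ?_⟩
  have h4 : {α | α ∈ D.posRoots cs \ {β} ∧ D.DomLE cs α β} = D.Dom cs β \ {β} := by
    ext α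
    exact ⟨fun h => ⟨⟨h.1.1, h.2⟩, h.1.2⟩, fun h => ⟨⟨h.1.1, h.2⟩, h.1.2⟩⟩
  rw [GeometricData.dpInf, h4, h2, Set.union_sdiff_left, h3.symm.sdiff_eq_left]
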